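/- Let $f:\mathbb{C}\to\mathbb{C}$ be a transcendental entire function, i.e. a holomorphic function on $\mathbb{C}$ that is not a polynomial. Call a family $\mathcal{H}$ of holomorphic functions on a domain $U\subset\mathbb{C}$ normal if every sequence in $\mathcal{H}$ has a subsequence that, locally uniformly on $U$, either converges to a holomorphic function or tends to $\infty$. Let the Fatou set $\mathcal{F}_f$ be the set of points of $\mathbb{C}$ that have a connected open neighbourhood on which the iterates $\{f^{\circ n}\}_{n\ge 0}$ form a normal family, and let the Julia set be $\mathcal{J}_f=\mathbb{C}\setminus\mathcal{F}_f$. Then $\mathcal{J}_f$ is infinite and perfect: it is a closed subset of $\mathbb{C}$, and every point of $\mathcal{J}_f$ is a limit of other points of $\mathcal{J}_f$. -/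

import Mathlib

open Filter Topology

/-- `f : ℂ → ℂ` is a transcendental entire function: holomorphic on all of `ℂ` and not a polynomial. -/
def IsTranscendentalEntire (f : ℂ → ℂ) : Prop :=
  Differentiable ℂ f ∧ ¬ ∃ p : Polynomial ℂ, ∀ z, f z = p.eval z

/-- The sequence `F` tends to `∞` uniformly on every compact subset of `U`. -/
def TendsToInftyLocallyUniformlyOn (F : ℕ → ℂ → ℂ) (U : Set ℂ) : Prop :=
  ∀ K ⊆ U, IsCompact K → ∀ M : ℝ, ∀ᶠ n in atTop, ∀ z ∈ K, M < ‖F n z‖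

/-- A family `H` of holomorphic functions is normal on the domain `U`: every sequence in `H` has a
subsequence which, locally uniformly on `U`, converges to a holomorphic function or tends to `∞`. -/
def IsNormalOn (H : Set (ℂ → ℂ)) (U : Set ℂ) : Prop :=
  ∀ F : ℕ → ℂ → ℂ, (∀ n, F n ∈ H) → ∃ φ : ℕ → ℕ, StrictMono φ ∧
    ((∃ g : ℂ → ℂ, DifferentiableOn ℂ g U ∧
        TendstoLocallyUniformlyOn (fun n => F (φ n)) g atTop U) ∨
      TendsToInftyLocallyUniformlyOn (fun n => F (φ n)) U)

/-- The Fatou set of `f`: the points that have a connected open neighbourhood on which the iterates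
of `f` form a normal family. -/
def fatouSet (f : ℂ → ℂ) : Set ℂ :=
  {z | ∃ U : Set ℂ, IsOpen U ∧ IsConnected U ∧ z ∈ U ∧
    IsNormalOn (Set.range fun n : ℕ => f^[n]) U}

/-- The Julia set of `f`: the complement of the Fatou set in `ℂ`. -/
def juliaSet (f : ℂ → ℂ) : Set ℂ := (fatouSet f)ᶜ

/-! Suppose `z₀` were isolated in the Julia set. Every other point of a small disc about `z₀` is
then in the Fatou set, which is forward invariant, so on that disc the iterates can meet the Julia
set only along the orbit of `z₀`. If the Julia set is infinite, two of its points are also avoided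
by that orbit from some time on, and Montel's test puts `z₀` in the Fatou set, a contradiction.

Infinitude uses transcendence. The Julia set is backward invariant, and of any two values at least
one is taken arbitrarily far out, so a finite Julia set has at most one point. Its complement would
be connected, so one bounded orbit in the Fatou set would force the iterates to be uniformly bounded
on a large circle, hence on its disc; this is impossible because images of large discs contain
circles of twice the radius. Thus points with bounded orbit would lie in the Julia set, and fixed
points of `f ∘ f` and `f`, found by Picard's theorem, exclude zero points and one point.

The analytic engine is Schottky's theorem, deduced from Bloch's: it yields Montel's test, Picard's
little theorem and the growth statements. -/

/-! ### Holomorphic logarithms -/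

open Complex Metric in
/-- A nonvanishing holomorphic function whose logarithmic derivative has a primitive has a
holomorphic logarithm. -/
theorem exists_differentiableOn_exp_eq {U : Set ℂ} (hU : IsOpen U) (hc : IsPreconnected U)
    {f : ℂ → ℂ} (hf : DifferentiableOn ℂ f U) (h0 : ∀ z ∈ U, f z ≠ 0)
    (hex : IsExactOn (fun z => deriv f z / f z) U) :
    ∃ g : ℂ → ℂ, DifferentiableOn ℂ g U ∧ ∀ z ∈ U, exp (g z) = f z := by
  rcases U.eq_empty_or_nonempty with rfl | ⟨c, hcU⟩
  · exact ⟨0, by simp, by simp⟩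
  obtain ⟨G, hG⟩ := hex
  have hd : ∀ z ∈ U, HasDerivAt (fun z => exp (-G z) * f z) 0 z := fun z hz => by
    have h1 := ((hG z hz).neg.cexp).mul
      ((hf.differentiableAt (hU.mem_nhds hz)).hasDerivAt)
    have h2 := h0 z hz
    refine HasDerivAt.congr_deriv h1 ?_
    simp only [Pi.neg_apply]
    field_simp
    ring
  have hconst : ∀ z ∈ U, exp (-G z) * f z = exp (-G c) * f c := fun z hz =>
    hU.is_const_of_deriv_eq_zero hc (fun w hw => (hd w hw).differentiableAt.differentiableWithinAt)
      (fun w hw => (hd w hw).deriv) hz hcU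
  refine ⟨fun z => G z + log (exp (-G c) * f c), fun z hz =>
    ((hG z hz).differentiableAt.add_const _).differentiableWithinAt, fun z hz => ?_⟩
  rw [exp_add, exp_log (mul_ne_zero (exp_ne_zero _) (h0 c hcU)), ← hconst z hz, ← mul_assoc,
    ← exp_add]
  simp

open Complex Metric in
theorem exists_differentiableOn_ball_exp_eq {c : ℂ} {r : ℝ} {f : ℂ → ℂ}
    (hf : DifferentiableOn ℂ f (ball c r)) (h0 : ∀ z ∈ ball c r, f z ≠ 0) :
    ∃ g : ℂ → ℂ, DifferentiableOn ℂ g (ball c r) ∧ ∀ z ∈ ball c r, exp (g z) = f z :=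
  exists_differentiableOn_exp_eq isOpen_ball (convex_ball c r).isPreconnected hf h0
    (((hf.deriv isOpen_ball).div hf h0).isExactOn_ball)

open Complex in
theorem exists_differentiable_exp_eq {f : ℂ → ℂ} (hf : Differentiable ℂ f) (h0 : ∀ z, f z ≠ 0) :
    ∃ g : ℂ → ℂ, Differentiable ℂ g ∧ ∀ z, exp (g z) = f z := by
  have hd : Differentiable ℂ (deriv f) := by
    rw [← differentiableOn_univ]; exact hf.differentiableOn.deriv isOpen_univ
  obtain ⟨g, hg, h⟩ := exists_differentiableOn_exp_eq isOpen_univ isPreconnected_univ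
    hf.differentiableOn (fun z _ => h0 z) ((hd.div hf h0).isExactOn_univ)
  exact ⟨g, differentiableOn_univ.1 hg, fun z => h z trivial⟩

/-! ### Estimates for the cosine and holomorphic arccosines -/

/-- Follows from |cos(x + iy)|² = cos² x + sinh² y. It bounds the imaginary part of an arccosine by
its cosine. -/
theorem Complex.abs_im_le_norm_cos (z : ℂ) : |z.im| ≤ ‖Complex.cos z‖ := by
  have h1 : ‖Complex.cos z‖ ^ 2 = Real.cos z.re ^ 2 + Real.sinh z.im ^ 2 := by
    have e : Complex.cos z = ((Real.cos z.re * Real.cosh z.im : ℝ) : ℂ) +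
        ((-(Real.sin z.re * Real.sinh z.im) : ℝ) : ℂ) * Complex.I := by
      rw [Complex.cos_eq z]; push_cast; ring
    rw [← Complex.normSq_eq_norm_sq, e, Complex.normSq_add_mul_I]
    linear_combination Real.cos z.re ^ 2 * Real.cosh_sq z.im +
      Real.sinh z.im ^ 2 * Real.sin_sq_add_cos_sq z.re
  have h2 : |z.im| ≤ |Real.sinh z.im| := by
    rw [Real.abs_sinh]; exact Real.self_le_sinh_iff.2 (abs_nonneg _)
  have h3 : |Real.sinh z.im| ≤ ‖Complex.cos z‖ := by
    refine abs_le_of_sq_le_sq ?_ (norm_nonneg _)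
    rw [h1]; nlinarith [sq_nonneg (Real.cos z.re)]
  exact h2.trans h3

theorem Complex.norm_cos_le_exp_norm (z : ℂ) : ‖Complex.cos z‖ ≤ Real.exp ‖z‖ := by
  have h1 : ‖Complex.exp (z * Complex.I)‖ ≤ Real.exp ‖z‖ :=
    (Complex.norm_exp_le_exp_norm _).trans (by simp)
  have h2 : ‖Complex.exp (-z * Complex.I)‖ ≤ Real.exp ‖z‖ :=
    (Complex.norm_exp_le_exp_norm _).trans (by simp)
  rw [Complex.cos, norm_div]
  have := norm_add_le (Complex.exp (z * Complex.I)) (Complex.exp (-z * Complex.I))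
  rw [Complex.norm_two]
  linarith

open Complex Metric in
/-- A holomorphic function on a disc omitting `1` and `-1` is of the form `cos (π U)` with `U`
holomorphic and controlled at the centre. -/
theorem exists_cos_pi_mul_eq {c : ℂ} {r : ℝ} (hr : 0 < r) {u : ℂ → ℂ}
    (hu : DifferentiableOn ℂ u (ball c r)) (h1 : ∀ z ∈ ball c r, u z ≠ 1)
    (h2 : ∀ z ∈ ball c r, u z ≠ -1) :
    ∃ U : ℂ → ℂ, DifferentiableOn ℂ U (ball c r) ∧ (∀ z ∈ ball c r, cos (Real.pi * U z) = u z) ∧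
      ‖U c‖ ≤ 1 + ‖u c‖ := by
  -- With `s` a square root of 1 - u², the function u + is has inverse u - is, so it equals exp K
  -- and u = cos(K/i).
  obtain ⟨L, hL, hLe⟩ := exists_differentiableOn_ball_exp_eq (f := fun z => 1 - u z ^ 2)
    ((differentiableOn_const 1).sub (hu.pow 2)) (fun z hz h => by
      have : (u z - 1) * (u z + 1) = 0 := by linear_combination -h
      rcases mul_eq_zero.1 this with h | h
      · exact h1 z hz (sub_eq_zero.1 h)
      · exact h2 z hz (eq_neg_of_add_eq_zero_left h))
  set s : ℂ → ℂ := fun z => exp (L z / 2) with hs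
  have hss : ∀ z ∈ ball c r, s z ^ 2 = 1 - u z ^ 2 := fun z hz => by
    rw [← hLe z hz, hs, ← exp_nat_mul]; congr 1; push_cast; ring
  have hprod : ∀ z ∈ ball c r, (u z + I * s z) * (u z - I * s z) = 1 := fun z hz => by
    linear_combination hss z hz - s z ^ 2 * I_sq
  obtain ⟨K, hK, hKe⟩ := exists_differentiableOn_ball_exp_eq (f := fun z => u z + I * s z)
    (hu.add ((differentiableOn_const I).mul (hL.div_const 2).cexp)) (fun z hz h => by
      have := hprod z hz
      simp [h] at this)
  have hpi : (Real.pi : ℂ) ≠ 0 := by exact_mod_cast Real.pi_ne_zero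
  -- Subtracting the even integer 2k preserves cos(π ·) and brings the real part at the centre into
  -- [-1, 1].
  set k : ℤ := round ((K c / (I * Real.pi)).re / 2) with hk
  have hcos : ∀ z ∈ ball c r, cos (Real.pi * (K z / (I * Real.pi) - 2 * k)) = u z := fun z hz => by
    have e1 : (Real.pi : ℂ) * (K z / (I * Real.pi) - 2 * k) = -I * K z - k * (2 * Real.pi) := by
      field_simp [hpi, I_ne_zero]
      linear_combination (K z) * I_sq
    rw [e1, cos_sub_int_mul_two_pi, cos]
    have e2 : -I * K z * I = K z := by linear_combination (-K z) * I_sq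
    have e3 : -(-I * K z) * I = -K z := by linear_combination (K z) * I_sq
    rw [e2, e3, exp_neg, hKe z hz, inv_eq_of_mul_eq_one_right (hprod z hz)]
    ring
  refine ⟨fun z => K z / (I * Real.pi) - 2 * k, (hK.div_const _).sub_const _, hcos, ?_⟩
  have hcc := hcos c (mem_ball_self hr)
  set w := K c / (I * Real.pi) - 2 * k with hw
  have hre : |w.re| ≤ 1 := by
    have := abs_sub_round ((K c / (I * Real.pi)).re / 2)
    rw [← hk] at this
    have e : w.re = 2 * ((K c / (I * Real.pi)).re / 2 - k) := by
      rw [hw]; simp; ring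
    rw [e, abs_mul, abs_two]; linarith
  have him : |w.im| ≤ ‖u c‖ := by
    have h3 := abs_im_le_norm_cos (Real.pi * w)
    rw [hcc] at h3
    refine le_trans ?_ h3
    simp only [mul_im, ofReal_re, ofReal_im, zero_mul, add_zero, abs_mul, abs_of_pos Real.pi_pos]
    nlinarith [abs_nonneg w.im, Real.pi_gt_three]
  exact (norm_le_abs_re_add_abs_im w).trans (add_le_add hre him)

/-! ### Bloch's theorem and Schottky's theorem -/

open Complex Metric in
/-- **Bloch's theorem**, with a non-optimal constant. -/
theorem exists_ball_subset_image_ball {c : ℂ} {R : ℝ} (hR : 0 < R) {f : ℂ → ℂ}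
    (hf : DifferentiableOn ℂ f (ball c R)) :
    ∃ b, ball b (R * ‖deriv f c‖ / 128) ⊆ f '' ball c R := by
  rcases eq_or_ne (deriv f c) 0 with h0 | h0
  · exact ⟨0, by simp [h0]⟩
  have hf' : DifferentiableOn ℂ (deriv f) (ball c R) := hf.deriv isOpen_ball
  have hsub : closedBall c (R / 2) ⊆ ball c R := closedBall_subset_ball (by linarith)
  -- Landau's device: at a maximum of this weighted derivative, |f'| at most doubles on a disc about
  -- `a` of half the remaining radius.
  obtain ⟨a, ha, hmax⟩ := (isCompact_closedBall c (R / 2)).exists_isMaxOn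
    ⟨c, mem_closedBall_self (by positivity)⟩
    (f := fun z => ‖deriv f z‖ * (R / 2 - dist z c))
    ((hf'.continuousOn.mono hsub).norm.mul (by fun_prop))
  have hmaxc : ‖deriv f c‖ * (R / 2) ≤ ‖deriv f a‖ * (R / 2 - dist a c) := by
    simpa using hmax (mem_closedBall_self (x := c) (by positivity : (0:ℝ) ≤ R / 2))
  set ρ := (R / 2 - dist a c) / 2 with hρ
  have hpos : 0 < ‖deriv f c‖ * (R / 2) := by positivity
  have ha0 : 0 < ‖deriv f a‖ := by
    by_contra h
    have : ‖deriv f a‖ = 0 := le_antisymm (not_lt.1 h) (norm_nonneg _)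
    rw [this] at hmaxc; linarith
  have hρ0 : 0 < ρ := by
    by_contra h
    have : R / 2 - dist a c ≤ 0 := by linarith
    nlinarith
  have hball : ball a ρ ⊆ closedBall c (R / 2) := fun z hz => by
    rw [mem_ball] at hz; rw [mem_closedBall]
    linarith [dist_triangle z a c]
  have hbd : ∀ z ∈ ball a ρ, ‖deriv f z‖ ≤ 2 * ‖deriv f a‖ := fun z hz => by
    have h1 : ‖deriv f z‖ * (R / 2 - dist z c) ≤ ‖deriv f a‖ * (R / 2 - dist a c) :=
      hmax (hball hz)
    rw [mem_ball] at hz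
    have h2 : ρ ≤ R / 2 - dist z c := by linarith [dist_triangle z a c]
    have h3 : ‖deriv f z‖ * ρ ≤ (2 * ‖deriv f a‖) * ρ := by
      calc ‖deriv f z‖ * ρ ≤ ‖deriv f z‖ * (R / 2 - dist z c) := by gcongr
        _ ≤ ‖deriv f a‖ * (R / 2 - dist a c) := h1
        _ = _ := by rw [hρ]; ring
    exact le_of_mul_le_mul_right h3 hρ0
  have hmaps : Set.MapsTo (deriv f) (ball a ρ) (closedBall (deriv f a) (4 * ‖deriv f a‖)) :=
    fun z hz => by
      rw [mem_closedBall, dist_eq_norm]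
      linarith [norm_sub_le (deriv f z) (deriv f a), hbd z hz]
  -- The Schwarz lemma for f' with bound 4|f'(a)| gives variation at most |f'(a)|/2 on radius ρ/8,
  -- so there f is close to its linear part.
  have hder : ∀ z ∈ closedBall a (ρ / 8), ‖deriv f z - deriv f a‖ ≤ ‖deriv f a‖ / 2 :=
    fun z hz => by
      have h1 := dist_le_div_mul_dist_of_mapsTo_ball (hf'.mono (hball.trans hsub)) hmaps
        (closedBall_subset_ball (by linarith) hz)
      rw [mem_closedBall] at hz
      rw [← dist_eq_norm]
      calc _ ≤ 4 * ‖deriv f a‖ / ρ * dist z a := h1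
        _ ≤ 4 * ‖deriv f a‖ / ρ * (ρ / 8) := by gcongr
        _ = _ := by field_simp; norm_num
  have hsub8 : closedBall a (ρ / 8) ⊆ ball c R :=
    (closedBall_subset_ball (by linarith)).trans (hball.trans hsub)
  have hlin : ∀ z ∈ closedBall a (ρ / 8),
      ‖(f z - deriv f a * z) - (f a - deriv f a * a)‖ ≤ ‖deriv f a‖ / 2 * ‖z - a‖ := fun z hz => by
    refine (convex_closedBall a (ρ / 8)).norm_image_sub_le_of_norm_hasDerivWithin_le
      (f := fun z => f z - deriv f a * z) (f' := fun z => deriv f z - deriv f a)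
      (fun w hw => ?_) hder (mem_closedBall_self (by positivity)) hz
    have h1 := (hf.differentiableAt (isOpen_ball.mem_nhds (hsub8 hw))).hasDerivAt
    simpa using! (h1.sub ((hasDerivAt_id w).const_mul (deriv f a))).hasDerivWithinAt
  have hsph : ∀ z ∈ sphere a (ρ / 8), ‖deriv f a‖ * ρ / 16 ≤ ‖f z - f a‖ := fun z hz => by
    have h1 := hlin z (sphere_subset_closedBall hz)
    rw [mem_sphere_iff_norm] at hz
    have h2 : ‖deriv f a * (z - a)‖ ≤ ‖f z - f a‖ +
        ‖(f z - deriv f a * z) - (f a - deriv f a * a)‖ := by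
      have := norm_sub_le (f z - f a) ((f z - deriv f a * z) - (f a - deriv f a * a))
      convert this using 2
      congr 1
      ring
    rw [norm_mul, hz] at h2
    rw [hz] at h1
    linarith
  have hdc : DiffContOnCl ℂ f (ball a (ρ / 8)) :=
    (hf.mono hsub8).diffContOnCl_ball subset_rfl
  have himg := hdc.ball_subset_image_closedBall (by positivity) hsph (by
    have h1 := (hf.differentiableAt (isOpen_ball.mem_nhds
      (hsub8 (mem_closedBall_self (by positivity))))).hasDerivAt
    exact (h1.eventually_ne (norm_pos_iff.1 ha0)).frequently.filter_mono nhdsWithin_le_nhds)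
  -- The image contains a disc of radius |f'(a)|ρ/32, and maximality gives |f'(a)|ρ ≥ R|f'(c)|/4;
  -- hence 128.
  refine ⟨f a, (ball_subset_ball ?_).trans (himg.trans (Set.image_mono hsub8))⟩
  have : ‖deriv f a‖ * (R / 2 - dist a c) = 2 * (‖deriv f a‖ * ρ) := by rw [hρ]; ring
  linarith

open Complex Metric in
/-- A holomorphic function on a disc whose image contains no disc of radius `2` varies by at most
an absolute constant on the concentric disc of half the radius. -/
theorem norm_sub_le_of_image_not_contain_ball {c : ℂ} {R : ℝ} (hR : 0 < R) {f : ℂ → ℂ}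
    (hf : DifferentiableOn ℂ f (ball c R)) (ho : ∀ w, ∃ v ∈ ball w 2, v ∉ f '' ball c R)
    {z : ℂ} (hz : z ∈ closedBall c (R / 2)) : ‖f z - f c‖ ≤ 256 := by
  -- A larger derivative would, by Bloch on radius R/2, put a disc of radius 2 in the image:
  -- (R/2)(512/R)/128 = 2.
  have hder : ∀ w ∈ closedBall c (R / 2), ‖deriv f w‖ ≤ 512 / R := fun w hw => by
    rw [mem_closedBall] at hw
    have hs : ball w (R / 2) ⊆ ball c R := ball_subset_ball' (by linarith)
    obtain ⟨b, hb⟩ := exists_ball_subset_image_ball (by positivity) (hf.mono hs)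
    obtain ⟨v, hv, hvn⟩ := ho b
    by_contra! hlt
    rw [div_lt_iff₀ hR] at hlt
    exact hvn (Set.image_mono hs (hb (ball_subset_ball (by linarith) hv)))
  have h := (convex_closedBall c (R / 2)).norm_image_sub_le_of_norm_deriv_le
    (fun w hw => hf.differentiableAt (isOpen_ball.mem_nhds
      (closedBall_subset_ball (by linarith) hw))) hder (mem_closedBall_self (by positivity)) hz
  refine h.trans ?_
  rw [mem_closedBall, dist_eq_norm] at hz
  calc _ ≤ 512 / R * (R / 2) := by gcongr
    _ = 256 := by field_simp; norm_num

open Complex Metric in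
/-- Every disc of radius `2` contains a point at which `cos (π z)` is an integer. -/
theorem exists_mem_ball_cos_pi_mul_eq_int (w : ℂ) :
    ∃ v ∈ ball w 2, ∃ n : ℤ, cos (Real.pi * v) = n := by
  -- cosh(πt) grows by at least 1 on [y, y + 1], so it takes an integer value there; it is the value
  -- of cos(π ·) at 2k + it.
  have hstep : ∀ y : ℝ, 0 ≤ y → ∃ t ∈ Set.Icc y (y + 1), ∃ n : ℤ, Real.cosh (Real.pi * t) = n := by
    intro y hy
    have hgap : Real.cosh (Real.pi * y) + 1 ≤ Real.cosh (Real.pi * (y + 1)) := by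
      have h1 : Real.pi * (y + 1) = Real.pi * y + Real.pi := by ring
      rw [h1, Real.cosh_add]
      have h2 : 0 ≤ Real.sinh (Real.pi * y) := Real.sinh_nonneg_iff.2 (by positivity)
      have h3 : 0 ≤ Real.sinh Real.pi := Real.sinh_nonneg_iff.2 Real.pi_pos.le
      have h4 := Real.one_le_cosh (Real.pi * y)
      have h5 : 2 ≤ Real.cosh Real.pi := by
        nlinarith [Real.self_le_sinh_iff.2 Real.pi_pos.le, Real.pi_gt_three, Real.cosh_sq Real.pi,
          Real.cosh_pos Real.pi]
      nlinarith [mul_nonneg h2 h3]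
    obtain ⟨t, ht, hte⟩ := intermediate_value_Icc (by linarith : y ≤ y + 1)
      (f := fun t => Real.cosh (Real.pi * t)) (by fun_prop)
      (show (⌈Real.cosh (Real.pi * y)⌉ : ℝ) ∈ _ from
        ⟨Int.le_ceil _, by linarith [Int.ceil_lt_add_one (Real.cosh (Real.pi * y))]⟩)
    exact ⟨t, ht, _, hte⟩
  obtain ⟨t, ht, n, hn⟩ : ∃ t : ℝ, |t - w.im| ≤ 1 ∧ ∃ n : ℤ, Real.cosh (Real.pi * t) = n := by
    rcases le_total 0 w.im with h | h
    · obtain ⟨t, ht, n, hn⟩ := hstep _ h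
      exact ⟨t, abs_le.2 ⟨by linarith [ht.1], by linarith [ht.2]⟩, n, hn⟩
    · obtain ⟨t, ht, n, hn⟩ := hstep (-w.im) (by linarith)
      refine ⟨-t, abs_le.2 ⟨by linarith [ht.2], by linarith [ht.1]⟩, n, ?_⟩
      rw [← hn, mul_neg, Real.cosh_neg]
  set k : ℤ := round (w.re / 2) with hk
  have hkre : |2 * (k : ℝ) - w.re| ≤ 1 := by
    have := abs_sub_round (w.re / 2)
    rw [← hk, abs_sub_comm] at this
    have e : 2 * (k : ℝ) - w.re = 2 * (k - w.re / 2) := by ring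
    rw [e, abs_mul, abs_two]; linarith
  refine ⟨2 * k + t * I, ?_, n, ?_⟩
  · rw [mem_ball, dist_eq_norm]
    have hsq : ‖(2 * k + t * I - w : ℂ)‖ ^ 2 = (2 * (k : ℝ) - w.re) ^ 2 + (t - w.im) ^ 2 := by
      rw [← normSq_eq_norm_sq, normSq_apply]; simp; ring
    have h1 := sq_le_one_iff_abs_le_one _ |>.2 hkre
    have h2 := sq_le_one_iff_abs_le_one _ |>.2 ht
    by_contra! h
    nlinarith
  · have e : (Real.pi : ℂ) * (2 * k + t * I) = ((Real.pi * t : ℝ) : ℂ) * I + k * (2 * Real.pi) := by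
      push_cast; ring
    rw [e, cos_add_int_mul_two_pi, cos_mul_I, ← ofReal_cosh, hn]
    simp

open Complex Metric in
/-- **Schottky's theorem**. -/
theorem exists_schottky_bound : ∃ S : ℝ → ℝ, ∀ (c : ℂ) (R M : ℝ) (f : ℂ → ℂ), 0 < R →
    DifferentiableOn ℂ f (ball c R) → (∀ z ∈ ball c R, f z ≠ 0) → (∀ z ∈ ball c R, f z ≠ 1) →
    ‖f c‖ ≤ M → ∀ z ∈ closedBall c (R / 2), ‖f z‖ ≤ S M := by
  refine ⟨fun M => (1 + Real.exp (Real.pi * Real.exp (Real.pi *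
    (256 + (1 + (1 + (2 * M + 1))))))) / 2, ?_⟩
  intro c R M f hR hf h0 h1 hM z hz
  have hzb : z ∈ ball c R := closedBall_subset_ball (by linarith) hz
  -- Two arccosines: 2f - 1 = cos(πU) omits ±1, so U omits all integers; then U = cos(πV), and the
  -- image of V misses every point where cos(π ·) is an integer. Hence V varies by at most 256, and
  -- |cos w| ≤ exp |w| applied twice returns to f.
  obtain ⟨U, hU, hUe, hUc⟩ := exists_cos_pi_mul_eq hR (u := fun z => 2 * f z - 1)
    ((hf.const_mul 2).sub_const 1)
    (fun w hw h => h1 w hw (by linear_combination h / 2))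
    (fun w hw h => h0 w hw (by linear_combination h / 2))
  have hUint : ∀ w ∈ ball c R, ∀ n : ℤ, U w ≠ n := fun w hw n hn => by
    have h2 := hUe w hw
    have h3 : cos (Real.pi * U w) ^ 2 = 1 := by
      have := sin_sq_add_cos_sq (Real.pi * U w)
      rw [hn, mul_comm, sin_int_mul_pi] at *
      simpa using this
    rw [h2] at h3
    have h4 : f w * (f w - 1) = 0 := by linear_combination h3 / 4
    rcases mul_eq_zero.1 h4 with h | h
    · exact h0 w hw h
    · exact h1 w hw (sub_eq_zero.1 h)
  obtain ⟨V, hV, hVe, hVc⟩ := exists_cos_pi_mul_eq hR hU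
    (fun w hw h => hUint w hw 1 (by simpa using h)) (fun w hw h => hUint w hw (-1) (by simpa using h))
  have hVz := norm_sub_le_of_image_not_contain_ball hR hV (fun w => by
    obtain ⟨v, hv, n, hn⟩ := exists_mem_ball_cos_pi_mul_eq_int w
    refine ⟨v, hv, ?_⟩
    rintro ⟨x, hx, rfl⟩
    exact hUint x hx n (by rw [← hVe x hx, hn])) hz
  have hfc : ‖2 * f c - 1‖ ≤ 2 * M + 1 := by
    refine (norm_sub_le _ _).trans ?_
    simp; linarith
  have hVn : ‖V z‖ ≤ 256 + (1 + (1 + (2 * M + 1))) := by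
    have := norm_le_norm_add_norm_sub' (V z) (V c)
    linarith
  have hpi : ∀ x : ℂ, ‖(Real.pi : ℂ) * x‖ = Real.pi * ‖x‖ := fun x => by
    rw [norm_mul, norm_real, Real.norm_of_nonneg Real.pi_pos.le]
  have hUn : ‖U z‖ ≤ Real.exp (Real.pi * (256 + (1 + (1 + (2 * M + 1))))) := by
    rw [← hVe z hzb]
    refine (norm_cos_le_exp_norm _).trans ?_
    rw [hpi]; gcongr
  have hfn : ‖2 * f z - 1‖ ≤ Real.exp (Real.pi * Real.exp (Real.pi *
      (256 + (1 + (1 + (2 * M + 1)))))) := by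
    rw [← hUe z hzb]
    refine (norm_cos_le_exp_norm _).trans ?_
    rw [hpi]; gcongr
  have : ‖f z‖ = ‖1 + (2 * f z - 1)‖ / 2 := by
    rw [show 1 + (2 * f z - 1) = 2 * f z by ring, norm_mul]; simp
  have h5 := norm_add_le 1 (2 * f z - 1)
  rw [norm_one] at h5
  rw [this]; linarith

/-! ### Montel's theorems -/

open Metric in
/-- **Montel's theorem** on a disc: a bounded sequence of holomorphic functions has a subsequence
converging uniformly on the concentric disc of half the radius. -/
theorem exists_subseq_tendstoUniformlyOn_of_norm_le {c : ℂ} {R C : ℝ} (hR : 0 < R)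
    {F : ℕ → ℂ → ℂ} (hF : ∀ n, DifferentiableOn ℂ (F n) (ball c R))
    (hC : ∀ n, ∀ z ∈ ball c R, ‖F n z‖ ≤ C) :
    ∃ φ : ℕ → ℕ, StrictMono φ ∧ ∃ g : ℂ → ℂ,
      TendstoUniformlyOn (fun n => F (φ n)) g atTop (closedBall c (R / 2)) := by
  classical
  have hsub : closedBall c (R / 2) ⊆ ball c R := closedBall_subset_ball (by linarith)
  have hder : ∀ n, ∀ z ∈ closedBall c (R / 2), ‖deriv (F n) z‖ ≤ C / (R / 4) := fun n z hz => by
    rw [mem_closedBall] at hz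
    have hs : closedBall z (R / 4) ⊆ ball c R := closedBall_subset_ball' (by linarith)
    exact Complex.norm_deriv_le_of_forall_mem_sphere_norm_le (by positivity)
      (((hF n).mono hs).diffContOnCl_ball subset_rfl)
      (fun w hw => hC n w (hs (sphere_subset_closedBall hw)))
  have hC0 : 0 ≤ C := (norm_nonneg _).trans (hC 0 c (mem_ball_self hR))
  set K : NNReal := ⟨C / (R / 4), by positivity⟩ with hK
  have hlip : ∀ n, LipschitzOnWith K (F n) (closedBall c (R / 2)) := fun n =>
    (convex_closedBall c (R / 2)).lipschitzOnWith_of_nnnorm_deriv_le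
      (fun z hz => (hF n).differentiableAt (isOpen_ball.mem_nhds (hsub hz)))
      (fun z hz => hder n z hz)
  let X := closedBall c (R / 2)
  -- Cauchy's estimate supplies one Lipschitz constant for the whole sequence; `S` is pointwise a
  -- closed subset of a product of compact discs, so Arzelà–Ascoli applies.
  let S : Set C(X, ℂ) := {h | (∀ x, h x ∈ closedBall (0 : ℂ) C) ∧ LipschitzWith K h}
  have hS : IsCompact S := by
    refine ArzelaAscoli.isCompact_of_equicontinuous S ?_ ?_
    · have himg : ContinuousMap.toFun '' S =
          (Set.univ.pi fun _ : X => closedBall (0 : ℂ) C) ∩ {h | LipschitzWith K h} := by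
        ext h
        constructor
        · rintro ⟨h, hh, rfl⟩
          exact ⟨fun x _ => hh.1 x, hh.2⟩
        · rintro ⟨h1, h2⟩
          exact ⟨⟨h, h2.continuous⟩, ⟨fun x => h1 x trivial, h2⟩, rfl⟩
      rw [himg]
      refine (isCompact_univ_pi fun _ => isCompact_closedBall 0 C).inter_right ?_
      have : {h : X → ℂ | LipschitzWith K h} =
          ⋂ x, ⋂ y, {h : X → ℂ | dist (h x) (h y) ≤ K * dist x y} := by
        ext h; simp [lipschitzWith_iff_dist_le_mul]
      rw [this]
      exact isClosed_iInter fun x => isClosed_iInter fun y =>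
        isClosed_le (by fun_prop) continuous_const
    · exact (LipschitzWith.uniformEquicontinuous _ K fun h : S => h.2.2).equicontinuous
  let G : ℕ → C(X, ℂ) := fun n => ⟨X.domRestrict (F n),
    continuousOn_iff_continuous_domRestrict.1 (hlip n).continuousOn⟩
  have hG : ∀ n, G n ∈ S := fun n =>
    ⟨fun x => by simpa [G] using hC n x (hsub x.2), fun x y => hlip n x.2 y.2⟩
  obtain ⟨h, -, φ, hφ, hlim⟩ := hS.tendsto_subseq hG
  -- The value 0 off the disc is immaterial: convergence is claimed only on the disc.
  refine ⟨φ, hφ, fun z => if hz : z ∈ X then h ⟨z, hz⟩ else 0, ?_⟩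
  rw [ContinuousMap.tendsto_iff_tendstoUniformly] at hlim
  rw [tendstoUniformlyOn_iff_tendstoUniformly_comp_coe]
  have hh : (fun z => if hz : z ∈ X then h ⟨z, hz⟩ else 0) ∘ ((↑) : X → ℂ) = h := by
    ext x; simp
  rw [hh]
  exact hlim

open Metric in
/-- **Schottky's theorem** for two arbitrary distinct omitted values. -/
theorem exists_schottky_bound_of_ne {a b : ℂ} (hab : a ≠ b) : ∃ S : ℝ → ℝ,
    ∀ (c : ℂ) (R M : ℝ) (f : ℂ → ℂ), 0 < R → DifferentiableOn ℂ f (ball c R) →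
    (∀ z ∈ ball c R, f z ≠ a) → (∀ z ∈ ball c R, f z ≠ b) →
    ‖f c‖ ≤ M → ∀ z ∈ closedBall c (R / 2), ‖f z‖ ≤ S M := by
  obtain ⟨S, hS⟩ := exists_schottky_bound
  refine ⟨fun M => S ((M + ‖a‖) / ‖b - a‖) * ‖b - a‖ + ‖a‖, ?_⟩
  intro c R M f hR hf ha hb hM z hz
  have hba : b - a ≠ 0 := sub_ne_zero.2 hab.symm
  have hn : 0 < ‖b - a‖ := norm_pos_iff.2 hba
  have h := hS c R ((M + ‖a‖) / ‖b - a‖) (fun z => (f z - a) / (b - a)) hR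
    ((hf.sub_const a).div_const _) (fun w hw h => ha w hw ?_) (fun w hw h => hb w hw ?_) ?_ z hz
  · rw [norm_div, div_le_iff₀ hn] at h
    have := norm_le_norm_add_norm_sub' (f z) a
    linarith
  · rcases div_eq_zero_iff.1 h with h | h
    · exact sub_eq_zero.1 h
    · exact absurd h hba
  · rw [div_eq_one_iff_eq hba] at h
    exact sub_left_injective h
  · rw [norm_div]
    gcongr
    exact (norm_sub_le _ _).trans (by gcongr)

open Metric in
/-- **Montel's fundamental normality test** for a sequence of functions on a disc. -/
theorem exists_subseq_of_omits_two_values {a b : ℂ} (hab : a ≠ b) {c : ℂ} {R : ℝ} (hR : 0 < R)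
    {F : ℕ → ℂ → ℂ} (hF : ∀ n, DifferentiableOn ℂ (F n) (ball c R))
    (ha : ∀ n, ∀ z ∈ ball c R, F n z ≠ a) (hb : ∀ n, ∀ z ∈ ball c R, F n z ≠ b) :
    ∃ φ : ℕ → ℕ, StrictMono φ ∧
      ((∃ g : ℂ → ℂ, DifferentiableOn ℂ g (ball c (R / 4)) ∧
        TendstoLocallyUniformlyOn (fun n => F (φ n)) g atTop (ball c (R / 4))) ∨
      TendsToInftyLocallyUniformlyOn (fun n => F (φ n)) (ball c (R / 4))) := by
  obtain ⟨S, hS⟩ := exists_schottky_bound_of_ne hab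
  by_cases hbd : ∃ M : ℝ, ∃ᶠ n in atTop, ‖F n c‖ ≤ M
  · obtain ⟨M, hM⟩ := hbd
    obtain ⟨ψ, hψ, hψM⟩ := extraction_of_frequently_atTop hM
    have hs2 : ball c (R / 2) ⊆ ball c R := ball_subset_ball (by linarith)
    obtain ⟨φ, hφ, g, hg⟩ := exists_subseq_tendstoUniformlyOn_of_norm_le (half_pos hR)
      (F := fun n => F (ψ n)) (C := S M) (fun n => (hF _).mono hs2)
      (fun n z hz => hS c R M _ hR (hF _) (ha _) (hb _) (hψM n) z (ball_subset_closedBall hz))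
    have hs4 : ball c (R / 4) ⊆ closedBall c (R / 2 / 2) := by
      rw [show R / 2 / 2 = R / 4 by ring]; exact ball_subset_closedBall
    have hlu := (hg.mono hs4).tendstoLocallyUniformlyOn
    refine ⟨ψ ∘ φ, hψ.comp hφ, Or.inl ⟨g, ?_, hlu⟩⟩
    exact hlu.differentiableOn (.of_forall fun n =>
      (hF _).mono (ball_subset_ball (by linarith))) isOpen_ball
  -- Here the values at `c` tend to ∞. Schottky is used backwards, centred at `z`: a value of size
  -- at most M at `z` would bound the value at `c` by `S M`.
  · refine ⟨id, strictMono_id, Or.inr fun K hK _ M => ?_⟩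
    push Not at hbd
    filter_upwards [hbd (S M)] with n hn z hz
    by_contra! hle
    have hzc := hK hz
    rw [mem_ball] at hzc
    have hs : ball z (R / 2) ⊆ ball c R := ball_subset_ball' (by linarith)
    refine absurd (hS z (R / 2) M (F n) (half_pos hR) ((hF n).mono hs)
      (fun w hw => ha n w (hs hw)) (fun w hw => hb n w (hs hw)) hle c ?_) (not_le.2 hn)
    rw [mem_closedBall, dist_comm]; linarith

/-! ### Growth and value distribution of entire functions -/

open Metric in
/-- An entire function of polynomial growth along a sequence of circles is a polynomial. -/
theorem exists_polynomial_of_norm_le_on_spheres {f : ℂ → ℂ} (hf : Differentiable ℂ f) (C : ℝ)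
    (m : ℕ) (h : ∀ r₀ : ℝ, ∃ r > r₀, ∀ z ∈ sphere (0 : ℂ) r, ‖f z‖ ≤ C * r ^ m) :
    ∃ p : Polynomial ℂ, ∀ z, f z = p.eval z := by
  have hz : ∀ n, m < n → iteratedDeriv n f 0 = 0 := fun n hn => by
    by_contra hne
    have hpos : 0 < ‖iteratedDeriv n f 0‖ := norm_pos_iff.2 hne
    -- Beyond this radius Cauchy's estimate, at most n! C / r since r > 1 and n > m, drops below the
    -- norm of the derivative.
    obtain ⟨r, hr, hb⟩ := h (max 1 (n.factorial * C / ‖iteratedDeriv n f 0‖))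
    have hr1 : 1 < r := (le_max_left _ _).trans_lt hr
    have hr0 : 0 < r := by linarith
    have h1 := Complex.norm_iteratedDeriv_le_of_forall_mem_sphere_norm_le n hr0
      hf.diffContOnCl hb
    have hC0 : 0 ≤ C := by
      have := (norm_nonneg _).trans (hb (r : ℂ) (by simp [hr0.le]))
      exact nonneg_of_mul_nonneg_left this (by positivity)
    have h2 : n.factorial * (C * r ^ m) / r ^ n ≤ n.factorial * C / r := by
      rw [div_le_div_iff₀ (by positivity) hr0]
      calc n.factorial * (C * r ^ m) * r = n.factorial * C * r ^ (m + 1) := by ring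
        _ ≤ n.factorial * C * r ^ n := by
          gcongr
          · exact hr1.le
          · exact hn
    have h3 := (le_max_right _ _).trans_lt hr
    rw [div_lt_iff₀ hpos] at h3
    have h4 := h1.trans h2
    rw [le_div_iff₀ hr0] at h4
    linarith
  refine ⟨∑ n ∈ Finset.range (m + 1),
    Polynomial.C ((n.factorial : ℂ)⁻¹ * iteratedDeriv n f 0) * Polynomial.X ^ n, fun z => ?_⟩
  rw [← Complex.taylorSeries_eq_of_entire' 0 z hf, tsum_eq_sum (s := Finset.range (m + 1))]
  · simp [Polynomial.eval_finsetSum]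
  · intro n hn
    rw [hz n (by simpa using hn)]
    simp

open Metric in
/-- **Picard's little theorem**. -/
theorem exists_forall_eq_of_omits_two_values {f : ℂ → ℂ} (hf : Differentiable ℂ f) {a b : ℂ}
    (hab : a ≠ b) (ha : ∀ z, f z ≠ a) (hb : ∀ z, f z ≠ b) : ∃ c, ∀ z, f z = c := by
  obtain ⟨S, hS⟩ := exists_schottky_bound_of_ne hab
  refine hf.exists_const_forall_eq_of_bounded
    (isBounded_iff_forall_norm_le.2 ⟨S ‖f 0‖, ?_⟩)
  rintro _ ⟨z, rfl⟩
  -- Schottky's bound does not depend on the radius, so the disc may grow with `z`.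
  exact hS 0 (2 * (‖z‖ + 1)) _ f (by positivity) hf.differentiableOn (fun w _ => ha w)
    (fun w _ => hb w) le_rfl z (by simp)

open Metric in
/-- The image of a large disc under a transcendental entire function contains a circle centred at
the origin of at least twice the radius. -/
theorem IsTranscendentalEntire.exists_sphere_subset_image {f : ℂ → ℂ}
    (hf : IsTranscendentalEntire f) : ∃ r₀ > 0, ∀ r ≥ r₀, ∃ ρ ≥ 2 * r,
      sphere (0 : ℂ) ρ ⊆ f '' ball 0 r := by
  by_contra! hcon
  obtain ⟨S, hS⟩ := exists_schottky_bound
  refine hf.2 (exists_polynomial_of_norm_le_on_spheres hf.1 (4 + 12 * |S 2|) 1 fun r₁ => ?_)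
  set r₀ := max (max 1 ‖f 0‖) (2 * r₁ + 1) with hr₀
  have h1 : 1 ≤ r₀ := (le_max_left _ _).trans (le_max_left _ _)
  have h2 : ‖f 0‖ ≤ r₀ := (le_max_right _ _).trans (le_max_left _ _)
  have h3 : 2 * r₁ + 1 ≤ r₀ := le_max_right _ _
  obtain ⟨r, hr, hn⟩ := hcon r₀ (by linarith)
  refine ⟨r / 2, by linarith, fun z hz => ?_⟩
  have hr0 : 0 < r := by linarith
  -- Values `a`, `b` omitted on the disc are chosen on the circles of radii 2r and 4r, so |b - a| is
  -- comparable to r. The normalised function omits 0 and 1 and is at most 2 at the origin, so on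
  -- |z| = r/2 Schottky gives |f| ≤ 2r + 6r|S 2|: linear growth.
  obtain ⟨a, ha, han⟩ := Set.not_subset.1 (hn (2 * r) le_rfl)
  obtain ⟨b, hb, hbn⟩ := Set.not_subset.1 (hn (4 * r) (by linarith))
  rw [mem_sphere_zero_iff_norm] at ha hb hz
  have hlow : 2 * r ≤ ‖b - a‖ := by linarith [norm_sub_norm_le b a]
  have hupp : ‖b - a‖ ≤ 6 * r := by linarith [norm_sub_le b a]
  have hn0 : 0 < ‖b - a‖ := by linarith
  have hba : b - a ≠ 0 := norm_pos_iff.1 hn0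
  have h := hS 0 r 2 (fun z => (f z - a) / (b - a)) hr0
    ((hf.1.differentiableOn.sub_const a).div_const _)
    (fun w hw h => ?_) (fun w hw h => ?_) ?_ z (by simp [hz])
  · rw [norm_div, div_le_iff₀ hn0] at h
    have h4 := norm_le_norm_add_norm_sub' (f z) a
    have h5 : S 2 * ‖b - a‖ ≤ |S 2| * (6 * r) := by
      gcongr
      exact le_abs_self _
    linarith
  · rcases div_eq_zero_iff.1 h with h | h
    · exact han ⟨w, hw, sub_eq_zero.1 h⟩
    · exact hba h
  · rw [div_eq_one_iff_eq hba] at h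
    exact hbn ⟨w, hw, sub_left_injective h⟩
  · rw [norm_div, div_le_iff₀ hn0]
    linarith [norm_sub_le (f 0) a]

open Metric in
/-- The iterates of a transcendental entire function are not uniformly bounded on large discs. -/
theorem IsTranscendentalEntire.exists_not_bounded_iterates {f : ℂ → ℂ}
    (hf : IsTranscendentalEntire f) :
    ∃ r > 0, ∀ M : ℝ, ∃ n, ∃ z ∈ closedBall (0 : ℂ) r, M < ‖f^[n] z‖ := by
  obtain ⟨r, hr, hs⟩ := hf.exists_sphere_subset_image
  refine ⟨r, hr, fun M => ?_⟩
  by_contra! hM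
  -- A bound for all iterates on one disc passes to a circle inside its image, at the cost of one
  -- iterate, and by the maximum principle to a disc of twice the radius. Eventually `f` itself is
  -- bounded on ℂ.
  have hall : ∀ k : ℕ, ∀ n, ∀ z ∈ closedBall (0 : ℂ) (2 ^ k * r), ‖f^[n] z‖ ≤ M := by
    intro k
    induction k with
    | zero => simpa using hM
    | succ k ih =>
      intro n z hz
      have hk : r ≤ 2 ^ k * r := le_mul_of_one_le_left hr.le (one_le_pow₀ one_le_two)
      obtain ⟨ρ, hρ, hsub⟩ := hs (2 ^ k * r) hk
      have hρ0 : ρ ≠ 0 := by linarith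
      refine Complex.norm_le_of_forall_mem_frontier_norm_le (U := ball 0 ρ) isBounded_ball
        (hf.1.iterate n).diffContOnCl (fun w hw => ?_) ?_
      · rw [frontier_ball _ hρ0] at hw
        obtain ⟨x, hx, rfl⟩ := hsub hw
        rw [← Function.iterate_succ_apply]
        exact ih (n + 1) x (ball_subset_closedBall hx)
      · rw [closure_ball _ hρ0]
        refine closedBall_subset_closedBall ?_ hz
        rw [pow_succ]; linarith
  refine hf.2 (exists_polynomial_of_norm_le_on_spheres hf.1 M 0 fun r₀ => ⟨r₀ + 1, by simp, ?_⟩)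
  intro z _
  obtain ⟨k, hk⟩ := pow_unbounded_of_one_lt (‖z‖ / r) one_lt_two
  have := hall k 1 z (by rw [mem_closedBall_zero_iff]; exact ((div_lt_iff₀ hr).1 hk).le)
  simpa using this

open Metric in
/-- An entire function tending to infinity at infinity is a polynomial. -/
theorem exists_polynomial_of_tendsto_norm_atTop {f : ℂ → ℂ} (hf : Differentiable ℂ f)
    (h : ∀ M : ℝ, ∃ r : ℝ, ∀ z, r < ‖z‖ → M < ‖f z‖) :
    ∃ p : Polynomial ℂ, ∀ z, f z = p.eval z := by
  obtain ⟨r₁, hr₁⟩ := h 1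
  set r := max r₁ 1 with hr
  have hr0 : 0 < r := lt_of_lt_of_le one_pos (le_max_right _ _)
  have hlt : ∀ z, r < ‖z‖ → 1 < ‖f z‖ := fun z hz => hr₁ z ((le_max_left _ _).trans_lt hz)
  -- In the coordinate w = 1/z, 1/f extends holomorphically over 0 with a zero of finite order n, so
  -- |f(z)| is at most a multiple of |z|ⁿ for large z.
  set g : ℂ → ℂ := fun w => (f w⁻¹)⁻¹ with hg
  have hbig : ∀ w ∈ ball (0 : ℂ) r⁻¹ \ {0}, 1 < ‖f w⁻¹‖ := fun w hw => by
    have h0 : 0 < ‖w‖ := norm_pos_iff.2 hw.2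
    apply hlt
    rw [norm_inv]
    exact (lt_inv_comm₀ h0 hr0).1 (mem_ball_zero_iff.1 hw.1)
  have hfne : ∀ w ∈ ball (0 : ℂ) r⁻¹ \ {0}, f w⁻¹ ≠ 0 := fun w hw =>
    norm_pos_iff.1 (by linarith [hbig w hw])
  have hnhds : ball (0 : ℂ) r⁻¹ ∈ 𝓝 0 := ball_mem_nhds _ (inv_pos.2 hr0)
  have hG := Complex.differentiableOn_update_limUnder_of_bddAbove (f := g) hnhds
    (fun w hw => ((hf.differentiableAt.comp w (differentiableAt_inv hw.2)).inv
      (hfne w hw)).differentiableWithinAt)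
    ⟨1, by
      rintro _ ⟨w, hw, rfl⟩
      simp only [Function.comp, hg, norm_inv]
      exact inv_le_one_of_one_le₀ (hbig w hw).le⟩
  set G := Function.update g 0 (limUnder (𝓝[≠] 0) g) with hGdef
  have hGne : ∀ w ∈ ball (0 : ℂ) r⁻¹ \ {0}, G w = (f w⁻¹)⁻¹ := fun w hw => by
    rw [hGdef, Function.update_of_ne hw.2]
  have hGa : AnalyticAt ℂ G 0 := hG.analyticAt hnhds
  have hnz : ¬ ∀ᶠ w in 𝓝 0, G w = 0 := fun hev => by
    have h1 : ∀ᶠ w in 𝓝[≠] (0 : ℂ), w ∈ ball (0 : ℂ) r⁻¹ \ {0} ∧ G w = 0 :=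
      ((eventually_nhdsWithin_of_eventually_nhds hnhds).and self_mem_nhdsWithin).and
        (eventually_nhdsWithin_of_eventually_nhds hev)
    obtain ⟨w, hw, hw0⟩ := h1.exists
    rw [hGne w hw] at hw0
    exact hfne w hw (inv_eq_zero.1 hw0)
  obtain ⟨n, k, hk, hk0, hkG⟩ := hGa.exists_eventuallyEq_pow_smul_nonzero_iff.2 hnz
  have hk2 : ∀ᶠ w in 𝓝 (0 : ℂ), ‖k 0‖ / 2 < ‖k w‖ :=
    hk.continuousAt.norm.eventually_const_lt (half_lt_self (norm_pos_iff.2 hk0))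
  obtain ⟨ε, hε, hball⟩ := Metric.eventually_nhds_iff_ball.1 (hkG.and hk2)
  refine exists_polynomial_of_norm_le_on_spheres hf (‖k 0‖ / 2)⁻¹ n fun r₀ => ?_
  set s := max (max r r₀) ε⁻¹ + 1 with hs
  have hs1 : r < s := by linarith [(le_max_left r r₀).trans (le_max_left _ ε⁻¹)]
  have hs2 : r₀ < s := by linarith [(le_max_right r r₀).trans (le_max_left _ ε⁻¹)]
  have hs3 : ε⁻¹ < s := by linarith [le_max_right (max r r₀) ε⁻¹]
  refine ⟨s, hs2, fun z hz => ?_⟩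
  rw [mem_sphere_zero_iff_norm] at hz
  have hs0 : 0 < s := hr0.trans hs1
  have hz0 : z ≠ 0 := norm_pos_iff.1 (by rw [hz]; exact hs0)
  have hw1 : z⁻¹ ∈ ball (0 : ℂ) r⁻¹ \ {0} := by
    refine ⟨?_, inv_ne_zero hz0⟩
    rw [mem_ball_zero_iff, norm_inv, hz]
    exact inv_strictAnti₀ hr0 hs1
  have hw2 : z⁻¹ ∈ ball (0 : ℂ) ε := by
    rw [mem_ball_zero_iff, norm_inv, hz]
    exact (inv_lt_comm₀ hε hs0).1 hs3
  obtain ⟨e1, e2⟩ := hball _ hw2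
  rw [hGne _ hw1, inv_inv, sub_zero, smul_eq_mul] at e1
  have e3 := congrArg norm e1
  rw [norm_inv, norm_mul, norm_pow, norm_inv, hz] at e3
  have hkp : 0 < ‖k 0‖ / 2 := half_pos (norm_pos_iff.2 hk0)
  have e4 : ‖f z‖ = ‖k z⁻¹‖⁻¹ * s ^ n := by
    rw [← inv_inv ‖f z‖, e3, mul_inv, inv_pow, inv_inv, mul_comm]
  rw [e4]
  gcongr

open Metric in
/-- A transcendental entire function takes all values but at most one outside every disc. -/
theorem IsTranscendentalEntire.exists_eq_or_eq_of_lt_norm {f : ℂ → ℂ}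
    (hf : IsTranscendentalEntire f) {a b : ℂ} (hab : a ≠ b) (r : ℝ) :
    ∃ z, r < ‖z‖ ∧ (f z = a ∨ f z = b) := by
  by_contra! hom
  obtain ⟨S, hS⟩ := exists_schottky_bound_of_ne hab
  set t := Real.log (max r 1) + 20 with ht
  have hmpos : 0 < max r 1 := lt_of_lt_of_le one_pos (le_max_right _ _)
  -- Schottky for `f ∘ exp` carries a bound at one point of a large circle to the whole circle.
  -- Logarithms of points on a circle differ by at most 2π < 10, half the radius 20, and the 20 in
  -- `t` keeps the exponential of that disc outside |z| ≤ r.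
  have hcirc : ∀ M : ℝ, ∀ z₁ z₂ : ℂ, Real.exp t < ‖z₁‖ → ‖z₂‖ = ‖z₁‖ → ‖f z₁‖ ≤ M →
      ‖f z₂‖ ≤ S M := by
    intro M z₁ z₂ h1 h2 h3
    have hp : 0 < ‖z₁‖ := (Real.exp_pos _).trans h1
    have hz1 : z₁ ≠ 0 := norm_pos_iff.1 hp
    have hz2 : z₂ ≠ 0 := norm_pos_iff.1 (h2 ▸ hp)
    have hlog : t < Real.log ‖z₁‖ := (Real.lt_log_iff_exp_lt hp).2 h1
    have hout : ∀ w ∈ ball (Complex.log z₁) 20, r < ‖Complex.exp w‖ := fun w hw => by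
      rw [mem_ball, dist_eq_norm] at hw
      have h4 := (Complex.abs_re_le_norm _).trans_lt hw
      rw [Complex.sub_re, Complex.log_re] at h4
      have h5 := (abs_lt.1 h4).1
      rw [Complex.norm_exp]
      refine (le_max_left r 1).trans_lt ((Real.log_lt_iff_lt_exp hmpos).1 ?_)
      linarith
    have h := hS (Complex.log z₁) 20 M (fun w => f (Complex.exp w)) (by norm_num)
      (hf.1.comp Complex.differentiable_exp).differentiableOn
      (fun w hw => (hom _ (hout w hw)).1) (fun w hw => (hom _ (hout w hw)).2)
      (by simpa [Complex.exp_log hz1] using h3) (Complex.log z₂) ?_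
    · simpa [Complex.exp_log hz2] using h
    · rw [mem_closedBall, dist_eq_norm]
      refine (Complex.norm_le_abs_re_add_abs_im _).trans ?_
      rw [Complex.sub_re, Complex.sub_im, Complex.log_re, Complex.log_re, h2, sub_self, abs_zero,
        zero_add]
      refine (abs_sub _ _).trans ?_
      rw [Complex.log_im, Complex.log_im]
      linarith [Complex.abs_arg_le_pi z₁, Complex.abs_arg_le_pi z₂, Real.pi_lt_four]
  by_cases hinf : ∀ M : ℝ, ∃ r : ℝ, ∀ z, r < ‖z‖ → M < ‖f z‖
  · exact hf.2 (exists_polynomial_of_tendsto_norm_atTop hf.1 hinf)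
  · push Not at hinf
    obtain ⟨M, hM⟩ := hinf
    refine hf.2 (exists_polynomial_of_norm_le_on_spheres hf.1 (S M) 0 fun r₀ => ?_)
    obtain ⟨z, hz, hzM⟩ := hM (max r₀ (Real.exp t))
    refine ⟨‖z‖, (le_max_left _ _).trans_lt hz, fun w hw => ?_⟩
    rw [pow_zero, mul_one]
    exact hcirc M z w ((le_max_right _ _).trans_lt hz) (mem_sphere_zero_iff_norm.1 hw) hzM

/-- The second iterate of a transcendental entire function has a fixed point. -/
theorem IsTranscendentalEntire.exists_fixed_point_comp_self {f : ℂ → ℂ}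
    (hf : IsTranscendentalEntire f) : ∃ z, f (f z) = z := by
  by_contra! hno
  have hno1 : ∀ z, f z - z ≠ 0 := fun z h => hno z (by rw [sub_eq_zero.1 h, sub_eq_zero.1 h])
  -- The quotient omits 0, which would fix z under `f ∘ f`, and 1, which would make f(z) a fixed
  -- point of `f`.
  obtain ⟨c, hc⟩ := exists_forall_eq_of_omits_two_values
    (f := fun z => (f (f z) - z) / (f z - z))
    (((hf.1.comp hf.1).sub differentiable_id).div (hf.1.sub differentiable_id) hno1)
    (zero_ne_one) (fun z h => by
      rcases div_eq_zero_iff.1 h with h | h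
      · exact hno z (sub_eq_zero.1 h)
      · exact hno1 z h)
    (fun z h => by
      rw [div_eq_one_iff_eq (hno1 z)] at h
      exact hno1 (f z) (sub_eq_zero.2 (sub_left_injective h)))
  have hc0 : c ≠ 0 := by
    rw [← hc 0]; exact div_ne_zero (sub_ne_zero.2 (hno 0)) (hno1 0)
  have hc1 : c ≠ 1 := fun h => by
    have h1 := hc 0
    rw [h, div_eq_one_iff_eq (hno1 0)] at h1
    exact hno1 (f 0) (sub_eq_zero.2 (sub_left_injective h1))
  have heq : ∀ z, f (f z) = z + c * (f z - z) := fun z => by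
    have := hc z
    rw [div_eq_iff (hno1 z)] at this
    linear_combination this
  -- Differentiating f(f(z)) = z + c(f(z) - z). Since c ≠ 1, f' ∘ f omits 0 and c, so it is
  -- constant; this relation then makes f' constant and f affine.
  have hder : ∀ z, deriv f z * (deriv f (f z) - c) = 1 - c := fun z => by
    have h1 : HasDerivAt (fun z => f (f z)) (deriv f (f z) * deriv f z) z :=
      (hf.1 (f z)).hasDerivAt.comp z (hf.1 z).hasDerivAt
    have h2 : HasDerivAt (fun z => z + c * (f z - z)) (1 + c * (deriv f z - 1)) z :=
      (hasDerivAt_id z).add (((hf.1 z).hasDerivAt.sub (hasDerivAt_id z)).const_mul c)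
    rw [← funext heq] at h2
    linear_combination h1.unique h2
  have hd0 : ∀ z, deriv f z ≠ 0 := fun z h => by
    have := hder z
    rw [h, zero_mul] at this
    exact hc1 (sub_eq_zero.1 this.symm).symm
  have hdc : ∀ z, deriv f (f z) ≠ c := fun z h => by
    have := hder z
    rw [h, sub_self, mul_zero] at this
    exact hc1 (sub_eq_zero.1 this.symm).symm
  have hdiff : Differentiable ℂ (deriv f) := by
    rw [← differentiableOn_univ]; exact hf.1.differentiableOn.deriv isOpen_univ
  obtain ⟨d, hd⟩ := exists_forall_eq_of_omits_two_values (hdiff.comp hf.1) hc0.symm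
    (fun z => hd0 (f z)) hdc
  have hdne : d - c ≠ 0 := by
    rw [← hd 0]; exact sub_ne_zero.2 (hdc 0)
  have hconst : ∀ z, deriv f z = (1 - c) / (d - c) := fun z => by
    rw [eq_div_iff hdne, ← hder z, ← hd z]; rfl
  set e := (1 - c) / (d - c)
  have hlin : ∀ z, f z - e * z = f 0 - e * 0 := fun z => by
    refine is_const_of_deriv_eq_zero (f := fun z => f z - e * z)
      (hf.1.sub (differentiable_id.const_mul e)) (fun w => ?_) z 0
    have := ((hf.1 w).hasDerivAt.sub ((hasDerivAt_id w).const_mul e)).deriv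
    rw [hconst w] at this
    simpa using! this
  refine hf.2 ⟨Polynomial.C e * Polynomial.X + Polynomial.C (f 0), fun z => ?_⟩
  simp
  linear_combination hlin z

/-! ### Invariance of the Fatou set -/

theorem isOpen_fatouSet (f : ℂ → ℂ) : IsOpen (fatouSet f) := by
  refine isOpen_iff_forall_mem_open.2 ?_
  rintro z ⟨U, hU, hUc, hz, hn⟩
  exact ⟨U, fun w hw => ⟨U, hU, hUc, hw, hn⟩, hU, hz⟩

theorem IsTranscendentalEntire.isOpenMap {f : ℂ → ℂ} (hf : IsTranscendentalEntire f) :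
    IsOpenMap f := by
  refine (AnalyticOnNhd.is_constant_or_isOpenMap
    (fun z _ => hf.1.analyticAt z)).resolve_left ?_
  rintro ⟨w, hw⟩
  exact hf.2 ⟨Polynomial.C w, fun z => by simp [hw z]⟩

/-- Compact subsets of the image of an open set under an open map lift to compact sets. -/
theorem IsOpenMap.exists_isCompact_subset_image {X Y : Type*} [TopologicalSpace X]
    [LocallyCompactSpace X] [TopologicalSpace Y] {f : X → Y} (hf : IsOpenMap f) {U : Set X}
    (hU : IsOpen U) {K : Set Y} (hK : IsCompact K) (hKU : K ⊆ f '' U) :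
    ∃ L ⊆ U, IsCompact L ∧ K ⊆ f '' L := by
  refine hK.induction_on (p := fun K => ∃ L ⊆ U, IsCompact L ∧ K ⊆ f '' L)
    ⟨∅, by simp, isCompact_empty, by simp⟩ ?_ ?_ ?_
  · rintro s t hst ⟨L, hL, hc, ht⟩
    exact ⟨L, hL, hc, hst.trans ht⟩
  · rintro s t ⟨L, hL, hc, hs⟩ ⟨L', hL', hc', ht⟩
    exact ⟨L ∪ L', Set.union_subset hL hL', hc.union hc', by
      rw [Set.image_union]; exact Set.union_subset_union hs ht⟩
  · intro y hy
    obtain ⟨x, hx, rfl⟩ := hKU hy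
    obtain ⟨L, hL, hLU, hc⟩ := local_compact_nhds (hU.mem_nhds hx)
    exact ⟨f '' L, mem_nhdsWithin_of_mem_nhds (hf.image_mem_nhds hL), L, hLU, hc, subset_rfl⟩

/-- Normality descends from U to f(U): precomposition with `f` turns iterates into iterates, and
since `f` is open, compact subsets of f(U) are covered by images of compact subsets of U. -/
theorem IsTranscendentalEntire.map_mem_fatouSet {f : ℂ → ℂ} (hf : IsTranscendentalEntire f)
    {z : ℂ} (hz : z ∈ fatouSet f) : f z ∈ fatouSet f := by
  obtain ⟨U, hU, hUc, hzU, hn⟩ := hz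
  have hV : IsOpen (f '' U) := hf.isOpenMap U hU
  refine ⟨f '' U, hV, hUc.image f hf.1.continuous.continuousOn, ⟨z, hzU, rfl⟩, ?_⟩
  intro F hF
  choose m hm using hF
  have hFd : ∀ n, Differentiable ℂ (F n) := fun n => by
    rw [← hm n]; exact hf.1.iterate _
  obtain ⟨φ, hφ, h⟩ := hn (fun n => F n ∘ f) fun n => ⟨m n + 1, by
    rw [← hm n]; exact Function.iterate_succ f (m n)⟩
  refine ⟨φ, hφ, ?_⟩
  rcases h with ⟨g, -, hg⟩ | h
  · left
    -- The section `s` need not be continuous. The limit `g` is constant on fibres of `f`, so `g ∘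
    -- s` is well behaved and is holomorphic as a locally uniform limit.
    choose! s hsU hs using fun y (hy : y ∈ f '' U) => hy
    have hgs : ∀ x ∈ U, g (s (f x)) = g x := fun x hx => by
      have hy : f x ∈ f '' U := ⟨x, hx, rfl⟩
      have h1 := hg.tendsto_at (hsU _ hy)
      have h2 := hg.tendsto_at hx
      simp only [Function.comp, hs _ hy] at h1
      exact tendsto_nhds_unique h1 h2
    have hlu : TendstoLocallyUniformlyOn (fun n => F (φ n)) (g ∘ s) atTop (f '' U) := by
      rw [tendstoLocallyUniformlyOn_iff_forall_isCompact hV]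
      intro K hKU hK
      obtain ⟨L, hLU, hL, hKL⟩ := hf.isOpenMap.exists_isCompact_subset_image hU hK hKU
      rw [Metric.tendstoUniformlyOn_iff]
      intro ε hε
      filter_upwards [Metric.tendstoUniformlyOn_iff.1
        ((tendstoLocallyUniformlyOn_iff_forall_isCompact hU).1 hg L hLU hL) ε hε] with n hn y hy
      obtain ⟨x, hx, rfl⟩ := hKL hy
      simpa [hgs x (hLU hx)] using hn x hx
    exact ⟨_, hlu.differentiableOn (.of_forall fun n => (hFd _).differentiableOn) hV, hlu⟩
  · right
    intro K hKU hK M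
    obtain ⟨L, hLU, hL, hKL⟩ := hf.isOpenMap.exists_isCompact_subset_image hU hK hKU
    filter_upwards [h L hLU hL M] with n hn y hy
    obtain ⟨x, hx, rfl⟩ := hKL hy
    exact hn x hx

theorem IsTranscendentalEntire.iterate_mem_fatouSet {f : ℂ → ℂ} (hf : IsTranscendentalEntire f)
    {z : ℂ} (hz : z ∈ fatouSet f) (n : ℕ) : f^[n] z ∈ fatouSet f := by
  induction n with
  | zero => exact hz
  | succ n ih => rw [Function.iterate_succ_apply']; exact hf.map_mem_fatouSet ih

/-! ### Infinitude of the Julia set -/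

/-- If the iterates are normal on `U` and some orbit starting in `U` is bounded, then the iterates
are uniformly bounded on compact subsets of `U`. -/
theorem exists_norm_iterate_le_of_isNormalOn {f : ℂ → ℂ} {U : Set ℂ} (hU : IsOpen U)
    (hn : IsNormalOn (Set.range fun n : ℕ => f^[n]) U) {w : ℂ} (hw : w ∈ U)
    (hb : ∃ M, ∀ n, ‖f^[n] w‖ ≤ M) {K : Set ℂ} (hKU : K ⊆ U) (hK : IsCompact K) :
    ∃ M, ∀ n, ∀ z ∈ K, ‖f^[n] z‖ ≤ M := by
  by_contra! hcon
  -- Iterates exceeding k at points of K: no subsequence can converge locally uniformly, and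
  -- divergence to ∞ is excluded at `w`.
  choose m z hzK hlt using fun k : ℕ => hcon k
  obtain ⟨φ, hφ, h⟩ := hn (fun k => f^[m k]) fun k => ⟨m k, rfl⟩
  rcases h with ⟨g, hg, hlu⟩ | h
  · obtain ⟨B, hB⟩ := hK.exists_bound_of_continuousOn (hg.continuousOn.mono hKU)
    have h1 := Metric.tendstoUniformlyOn_iff.1
      ((tendstoLocallyUniformlyOn_iff_forall_isCompact hU).1 hlu K hKU hK) 1 one_pos
    obtain ⟨j, hj, hjB⟩ := (h1.and (eventually_ge_atTop ⌈B + 1⌉₊)).exists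
    have h2 := hj _ (hzK (φ j))
    rw [dist_eq_norm, norm_sub_rev] at h2
    have h3 := norm_le_norm_add_norm_sub' (f^[m (φ j)] (z (φ j))) (g (z (φ j)))
    have h4 : (j : ℝ) ≤ φ j := by exact_mod_cast hφ.id_le j
    linarith [hB _ (hzK (φ j)), hlt (φ j), Nat.ceil_le.1 hjB]
  · obtain ⟨M, hM⟩ := hb
    obtain ⟨j, hj⟩ := (h {w} (by simpa using hw) isCompact_singleton M).exists
    linarith [hj w rfl, hM (m (φ j))]

open Metric in
/-- If the Julia set is finite, no point of the Fatou set has a bounded orbit. -/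
theorem IsTranscendentalEntire.mem_juliaSet_of_bounded_orbit {f : ℂ → ℂ}
    (hf : IsTranscendentalEntire f) (hfin : (juliaSet f).Finite) {p : ℂ}
    (hp : ∃ M, ∀ n, ‖f^[n] p‖ ≤ M) : p ∈ juliaSet f := by
  by_contra hpF
  replace hpF : p ∈ fatouSet f := not_not.1 hpF
  -- Normality makes `B` open and relatively closed in the Fatou set, which is connected as the
  -- complement of a finite set. Hence `B` is the whole Fatou set, and the iterates are bounded on a
  -- large circle contained in it.
  let B : Set ℂ := {z | z ∈ fatouSet f ∧ ∃ M, ∀ n, ‖f^[n] z‖ ≤ M}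
  have hpre : IsPreconnected (fatouSet f) := by
    have h := hfin.countable.isPathConnected_compl_of_one_lt_rank (E := ℂ) (by
      rw [Complex.rank_real_complex]; exact_mod_cast one_lt_two)
    rw [juliaSet, compl_compl] at h
    exact h.isConnected.isPreconnected
  have hprop : ∀ U : Set ℂ, IsOpen U → IsConnected U →
      IsNormalOn (Set.range fun n : ℕ => f^[n]) U → (U ∩ B).Nonempty → U ⊆ B := by
    rintro U hU hUc hn ⟨w, hwU, -, hwb⟩ z hz
    refine ⟨⟨U, hU, hUc, hz, hn⟩, ?_⟩
    obtain ⟨M, hM⟩ := exists_norm_iterate_le_of_isNormalOn hU hn hwU hwb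
      (Set.singleton_subset_iff.2 hz) isCompact_singleton
    exact ⟨M, fun n => hM n z rfl⟩
  have hBo : IsOpen B := isOpen_iff_forall_mem_open.2 fun z hz => by
    obtain ⟨U, hU, hUc, hzU, hn⟩ := hz.1
    exact ⟨U, hprop U hU hUc hn ⟨z, hzU, hz⟩, hU, hzU⟩
  have hFB : fatouSet f ⊆ B := by
    refine hpre.subset_of_closure_inter_subset hBo ⟨p, hpF, hpF, hp⟩ ?_
    rintro z ⟨hzcl, U, hU, hUc, hzU, hn⟩
    exact hprop U hU hUc hn (mem_closure_iff.1 hzcl U hU hzU) hzU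
  obtain ⟨r, hr, hunb⟩ := hf.exists_not_bounded_iterates
  obtain ⟨R, hR⟩ := hfin.isBounded.subset_ball 0
  set s := max r R with hs
  have hs0 : s ≠ 0 := by linarith [le_max_left r R]
  have hsph : sphere (0 : ℂ) s ⊆ fatouSet f := fun z hz => by
    by_contra hzJ
    have h1 := hR (show z ∈ juliaSet f from hzJ)
    rw [mem_ball_zero_iff] at h1
    rw [mem_sphere_zero_iff_norm] at hz
    linarith [le_max_right r R]
  obtain ⟨M, hM⟩ : ∃ M, ∀ n, ∀ z ∈ sphere (0 : ℂ) s, ‖f^[n] z‖ ≤ M := by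
    refine (isCompact_sphere (0 : ℂ) s).induction_on
      (p := fun K => ∃ M, ∀ n, ∀ z ∈ K, ‖f^[n] z‖ ≤ M) ⟨0, by simp⟩ ?_ ?_ ?_
    · rintro K L hKL ⟨M, hM⟩
      exact ⟨M, fun n z hz => hM n z (hKL hz)⟩
    · rintro K L ⟨M, hM⟩ ⟨M', hM'⟩
      refine ⟨max M M', fun n z hz => ?_⟩
      rcases hz with hz | hz
      · exact (hM n z hz).trans (le_max_left _ _)
      · exact (hM' n z hz).trans (le_max_right _ _)
    · intro z hz
      obtain ⟨U, hU, hUc, hzU, hn⟩ := hsph hz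
      obtain ⟨L, hL, hLU, hc⟩ := local_compact_nhds (hU.mem_nhds hzU)
      exact ⟨L, mem_nhdsWithin_of_mem_nhds hL,
        exists_norm_iterate_le_of_isNormalOn hU hn hzU (hFB (hsph hz)).2 hLU hc⟩
  obtain ⟨n, z, hz, hlt⟩ := hunb M
  refine absurd (Complex.norm_le_of_forall_mem_frontier_norm_le (U := ball 0 s) isBounded_ball
    (hf.1.iterate n).diffContOnCl (fun w hw => ?_) ?_) (not_le.2 hlt)
  · rw [frontier_ball _ hs0] at hw
    exact hM n w hw
  · rw [closure_ball _ hs0]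
    exact closedBall_subset_closedBall (le_max_left _ _) hz

/-- A transcendental entire function omitting the value `a` except possibly at `a` has a fixed
point other than `a`. -/
theorem IsTranscendentalEntire.exists_fixed_point_ne {f : ℂ → ℂ} (hf : IsTranscendentalEntire f)
    {a : ℂ} (ha : ∀ z, f z = a → z = a) : ∃ z ≠ a, f z = z := by
  by_contra! hno
  -- In the coordinate z = a + exp w, `f` lifts to `Ψ`, and Ψ(w) - w in 2πiℤ would give a fixed
  -- point other than `a`. Omitting 0 and 2πi, this difference is constant, so `f` is affine.
  obtain ⟨Ψ, hΨ, hΨe⟩ := exists_differentiable_exp_eq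
    (f := fun w => f (a + Complex.exp w) - a)
    ((hf.1.comp (Complex.differentiable_exp.const_add a)).sub_const a) (fun w h => by
      have := ha _ (sub_eq_zero.1 h)
      simp at this)
  have homit : ∀ w, ∀ n : ℤ, Ψ w - w ≠ n * (2 * Real.pi * Complex.I) := fun w n h => by
    refine hno (a + Complex.exp w) (by simp) ?_
    have h1 := hΨe w
    rw [show Ψ w = w + n * (2 * Real.pi * Complex.I) by linear_combination h,
      Complex.exp_add, Complex.exp_int_mul_two_pi_mul_I, mul_one] at h1
    linear_combination -h1
  obtain ⟨c, hc⟩ := exists_forall_eq_of_omits_two_values (hΨ.sub differentiable_id)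
    Complex.two_pi_I_ne_zero.symm (fun w h => homit w 0 (by simpa using h))
    (fun w h => homit w 1 (by simpa using h))
  have hexp : ∀ z, z ≠ a → f z = a + Complex.exp c * (z - a) := fun z hz => by
    have hz' : z - a ≠ 0 := sub_ne_zero.2 hz
    have h1 := hΨe (Complex.log (z - a))
    have h2 : Ψ (Complex.log (z - a)) = c + Complex.log (z - a) := by
      have h3 : Ψ (Complex.log (z - a)) - Complex.log (z - a) = c := hc _
      linear_combination h3
    rw [h2, Complex.exp_add, Complex.exp_log hz'] at h1
    simp only [add_sub_cancel] at h1
    linear_combination -h1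
  refine hf.2 ⟨Polynomial.C a + Polynomial.C (Complex.exp c) * (Polynomial.X - Polynomial.C a),
    fun z => ?_⟩
  have hfun : f = fun z => a + Complex.exp c * (z - a) :=
    Continuous.ext_on (dense_compl_singleton a) hf.1.continuous (by fun_prop) fun z hz => hexp z hz
  simp [congrFun hfun z]

/-- A finite Julia set would contain every point with bounded orbit: a fixed point of `f ∘ f` rules
out the empty set, and a second fixed point of `f` rules out {a}, where backward invariance gives
f⁻¹(a) ⊆ {a}. With two points, preimages arbitrarily far out contradict boundedness. -/
theorem IsTranscendentalEntire.infinite_juliaSet {f : ℂ → ℂ} (hf : IsTranscendentalEntire f) :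
    (juliaSet f).Infinite := by
  intro hfin
  have hback : ∀ z, f z ∈ juliaSet f → z ∈ juliaSet f := fun z hz hzF =>
    hz (hf.map_mem_fatouSet hzF)
  rcases (juliaSet f).subsingleton_or_nontrivial with hsub | ⟨a, ha, b, hb, hab⟩
  · rcases hsub.eq_empty_or_singleton with h | ⟨a, h⟩
    · obtain ⟨z, hz⟩ := hf.exists_fixed_point_comp_self
      have hit : ∀ n, f^[n] z = z ∨ f^[n] z = f z := fun n => by
        induction n with
        | zero => simp
        | succ n ih =>
          rw [Function.iterate_succ_apply']
          rcases ih with ih | ih <;> rw [ih]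
          · exact Or.inr rfl
          · exact Or.inl hz
      have hmem := hf.mem_juliaSet_of_bounded_orbit hfin
        (p := z) ⟨max ‖z‖ ‖f z‖, fun n => by rcases hit n with h | h <;> simp [h]⟩
      rw [h] at hmem
      exact hmem
    · rw [h] at hback
      obtain ⟨z, hza, hz⟩ := hf.exists_fixed_point_ne (a := a) fun z hz => by
        simpa using hback z (by simp [hz])
      have hmem := hf.mem_juliaSet_of_bounded_orbit hfin
        (p := z) ⟨‖z‖, fun n => by rw [Function.iterate_fixed hz]⟩
      rw [h] at hmem
      exact hza hmem
  · obtain ⟨R, hR⟩ := hfin.isBounded.subset_ball 0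
    obtain ⟨z, hz, h⟩ := hf.exists_eq_or_eq_of_lt_norm hab R
    have hzJ : z ∈ juliaSet f := hback z (by rcases h with h | h <;> rw [h] <;> assumption)
    have := hR hzJ
    rw [mem_ball_zero_iff] at this
    linarith

/-! ### Perfectness of the Julia set -/

open Metric in
/-- If all but finitely many iterates of an entire function omit two values near a point, then the
point belongs to the Fatou set. -/
theorem mem_fatouSet_of_iterates_omit {f : ℂ → ℂ} (hf : Differentiable ℂ f) {a b c : ℂ}
    (hab : a ≠ b) {R : ℝ} (hR : 0 < R) {N : ℕ}
    (ha : ∀ n ≥ N, ∀ z ∈ ball c R, f^[n] z ≠ a) (hb : ∀ n ≥ N, ∀ z ∈ ball c R, f^[n] z ≠ b) :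
    c ∈ fatouSet f := by
  have hR4 : 0 < R / 4 := by positivity
  refine ⟨ball c (R / 4), isOpen_ball, (convex_ball _ _).isConnected ⟨c, mem_ball_self hR4⟩,
    mem_ball_self hR4, fun F hF => ?_⟩
  choose m hm using hF
  -- Either infinitely many terms have index at least N and Montel's test applies, or a single early
  -- iterate recurs infinitely often and gives a constant subsequence.
  by_cases hev : ∃ᶠ k in atTop, N ≤ m k
  · obtain ⟨ψ, hψ, hψN⟩ := extraction_of_frequently_atTop hev
    obtain ⟨φ, hφ, h⟩ := exists_subseq_of_omits_two_values hab hR (F := fun k => F (ψ k))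
      (fun k => by rw [← hm]; exact (hf.iterate _).differentiableOn)
      (fun k z hz => by rw [← hm]; exact ha _ (hψN k) z hz)
      (fun k z hz => by rw [← hm]; exact hb _ (hψN k) z hz)
    exact ⟨ψ ∘ φ, hψ.comp hφ, h⟩
  · rw [not_frequently] at hev
    obtain ⟨i, -, hi⟩ : ∃ i ∈ Finset.range N, ∃ᶠ k in atTop, m k = i := by
      by_contra! hcon
      have h1 : ∀ᶠ k in atTop, ∀ i ∈ Finset.range N, m k ≠ i :=
        (Filter.eventually_all_finset _).2 fun i hi => hcon i hi
      obtain ⟨k, hk, hk'⟩ := (hev.and h1).exists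
      exact hk' (m k) (Finset.mem_range.2 (not_le.1 hk)) rfl
    obtain ⟨φ, hφ, hφi⟩ := extraction_of_frequently_atTop hi
    refine ⟨φ, hφ, Or.inl ⟨f^[i], (hf.iterate i).differentiableOn, ?_⟩⟩
    have hconst : (fun n => F (φ n)) = fun _ => f^[i] := funext fun n => by rw [← hm, hφi n]
    rw [hconst]
    refine TendstoUniformlyOn.tendstoLocallyUniformlyOn ?_
    rw [Metric.tendstoUniformlyOn_iff]
    exact fun ε hε => .of_forall fun _ z _ => by simpa using hε

theorem mainTheorem2 (f : ℂ → ℂ) (hf : IsTranscendentalEntire f) :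
    (juliaSet f).Infinite ∧ Perfect (juliaSet f) := by
  have hinf := hf.infinite_juliaSet
  refine ⟨hinf, (isOpen_fatouSet f).isClosed_compl, fun z₀ hz₀ => ?_⟩
  by_contra hacc
  rw [accPt_iff_nhds] at hacc
  push Not at hacc
  obtain ⟨U, hU, hUJ⟩ := hacc
  obtain ⟨R, hR, hRU⟩ := Metric.mem_nhds_iff.1 hU
  -- An infinite orbit visits each point at most once, so any two Julia points work for large N; a
  -- finite orbit misses two points of the infinite Julia set.
  obtain ⟨a, ha, b, hb, hab, N, hN⟩ : ∃ a ∈ juliaSet f, ∃ b ∈ juliaSet f, a ≠ b ∧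
      ∃ N, ∀ n ≥ N, f^[n] z₀ ≠ a ∧ f^[n] z₀ ≠ b := by
    by_cases hinj : Function.Injective fun n => f^[n] z₀
    · obtain ⟨a, ha, b, hb, hab⟩ := hinf.nontrivial
      have hev : ∀ c, ∀ᶠ n in atTop, f^[n] z₀ ≠ c := fun c => by
        rw [← Nat.cofinite_eq_atTop]
        exact hinj.tendsto_cofinite.eventually (eventually_cofinite_ne c)
      obtain ⟨N, hN⟩ := eventually_atTop.1 ((hev a).and (hev b))
      exact ⟨a, ha, b, hb, hab, N, hN⟩
    · have hfin : (Set.range fun n => f^[n] z₀).Finite := by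
        simp only [Function.Injective, not_forall] at hinj
        obtain ⟨i, j, hij, hne⟩ := hinj
        wlog hlt : i < j generalizing i j
        · exact this j i hij.symm (Ne.symm hne) (lt_of_le_of_ne (not_lt.1 hlt) (Ne.symm hne))
        refine ((Finset.range j).image fun n => f^[n] z₀).finite_toSet.subset ?_
        rintro _ ⟨n, rfl⟩
        induction n using Nat.strong_induction_on with
        | _ n ih =>
          by_cases hn : n < j
          · exact Finset.mem_coe.2 (Finset.mem_image_of_mem _ (Finset.mem_range.2 hn))
          · have h1 : f^[n] z₀ = f^[n - j + i] z₀ := by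
              rw [Function.iterate_add_apply, show f^[i] z₀ = f^[j] z₀ from hij,
                ← Function.iterate_add_apply, Nat.sub_add_cancel (not_lt.1 hn)]
            simp only [h1]
            exact ih _ (by omega)
      obtain ⟨a, ha, b, hb, hab⟩ := (hinf.sdiff hfin).nontrivial
      exact ⟨a, ha.1, b, hb.1, hab, 0, fun n _ =>
        ⟨fun h => ha.2 ⟨n, h⟩, fun h => hb.2 ⟨n, h⟩⟩⟩
  have homit : ∀ c ∈ juliaSet f, (∀ n ≥ N, f^[n] z₀ ≠ c) →
      ∀ n ≥ N, ∀ z ∈ Metric.ball z₀ R, f^[n] z ≠ c := fun c hc h n hn z hz he => by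
    by_cases hzz : z = z₀
    · exact h n hn (hzz ▸ he)
    · have hzF : z ∈ fatouSet f := by
        by_contra hzJ
        exact hzz (hUJ z ⟨hRU hz, hzJ⟩)
      exact hc (he ▸ hf.iterate_mem_fatouSet hzF n)
  exact hz₀ (mem_fatouSet_of_iterates_omit hf.1 hab hR (homit a ha fun n hn => (hN n hn).1)
    (homit b hb fun n hn => (hN n hn).2))
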